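/- Let $k:\mathcal X\times\mathcal X\to\mathbb R$ be a positive definite kernel on a set $\mathcal X$ (for all finite families of points the matrix of pairwise evaluations is symmetric positive semidefinite), let $x_1,\dots,x_n\in\mathcal X$, let $K=(k(x_i,x_j))_{i,j}\in\mathbb R^{n\times n}$, and let $R\in\mathbb R^{n\times n}$ be an upper triangular matrix with $R^TR=K$. Put $\Psi_i=R_{:,i}\otimes I_d\in\mathbb R^{nd\times d}$, where $R_{:,i}$ is the $i$-th column of $R$. Write $\mathbb S(\mathbb R^m)$ for the symmetric and $\mathbb S(\mathbb R^m)_+$ for the symmetric positive semidefinite real $m\times m$ matrices, $\langle A,B\rangle=\operatorname{tr}(A^TB)$, $\|A\|_F^2=\langle A,A\rangle$, and $[M]_-=U\max(0,-\Sigma)U^T$ for the negative part of a symmetric matrix $M=U\Sigma U^T$ ($U$ orthogonal, $\Sigma$ diagonal). Let $L:\mathbb S(\mathbb R^d)^n\to\mathbb R\cup\{+\infty\}$ be convex, lower semicontinuous and bounded from below, with effective domain $\operatorname{dom}L=\{X: L(X)<+\infty\}$ and Fenchel conjugate $$L^*(Y)=\sup_{X\in\mathbb S(\mathbb R^d)^n}\Big\{\sum_{i=1}^n\langle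 Y^{(i)},X^{(i)}\rangle-L(X)\Big\}.$$ For $\lambda_1,\lambda_2\ge 0$ consider the problem $$(P)\qquad \inf_{B\in\mathbb S(\mathbb R^{nd})_+}\; L\big(\Psi_1^TB\Psi_1,\dots,\Psi_n^TB\Psi_n\big)+\lambda_1\operatorname{tr}B+\frac{\lambda_2}{2}\|B\|_F^2,$$ and assume that it has a feasible point, i.e. $(\Psi_i^TB\Psi_i)_{i}\in\operatorname{dom}L$ for some $B\in\mathbb S(\mathbb R^{nd})_+$. (i) If $\lambda_2>0$ and $\lambda_1\ge0$, then the value of $(P)$ equals $$(D)\qquad \sup_{\Gamma\in\mathbb S(\mathbb R^d)^n}\; -L^*(\Gamma)-\frac1{2\lambda_2}\Big\|\Big[\sum_{i=1}^n\Psi_i\Gamma^{(i)}\Psi_i^T+\lambda_1I_{nd}\Big]_-\Big\|_F^2 .$$ The supremum in $(D)$ is attained if $(\Psi_i^TB\Psi_i)_{i}$ lies in the interior of $\operatorname{dom}L$ for some $B\in\mathbb S(\mathbb R^{nd})_+$; in particular it is attained whenever $L$ is finite everywhere. Further, if $\Gamma_\star$ is an optimal solution of $(D)$, then $$B^\star=\frac1{\lambda_2}\Big[\sum_{i=1}^n\Psi_i\Gamma_\star^{(i)}\Psi_i^T+\lambda_1I_{nd}\Big]_-$$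 is positive semidefinite and is an optimal solution of $(P)$. (ii) If $\lambda_2=0$ and $\lambda_1>0$, then the value of $(P)$ equals $$\sup_{\Gamma\in\mathbb S(\mathbb R^d)^n}\; -L^*(\Gamma)\quad\text{subject to}\quad \sum_{i=1}^n\Psi_i\Gamma^{(i)}\Psi_i^T+\lambda_1I_{nd}\succeq0 .$$ -/

import Mathlib

open scoped Matrix

noncomputable section

namespace PSDLearning

/-- The real vector space of symmetric matrices with index type `m`. -/
def symMat (m : Type) : Submodule ℝ (Matrix m m ℝ) where
  carrier := {A | A.IsSymm}
  add_mem' hA hB := Matrix.IsSymm.add hA hB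
  zero_mem' := Matrix.isSymm_zero
  smul_mem' c _ hA := Matrix.IsSymm.smul hA c

/-- The Frobenius inner product `tr (Aᵀ B)`. -/
def frobInner {m : Type} [Fintype m] (A B : Matrix m m ℝ) : ℝ := (Aᵀ * B).trace

/-- The squared Frobenius norm `tr (Aᵀ A)`. -/
def frobSq {m : Type} [Fintype m] (A : Matrix m m ℝ) : ℝ := frobInner A A

/-- The cone of positive semidefinite matrices. -/
def psdCone (m : Type) : Set (symMat m) := {B | B.1.PosSemidef}

/-- The negative part `U max(0, -Σ) Uᵀ` of a symmetric matrix `U Σ Uᵀ`, given by the functional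
calculus with the function `t ↦ max (-t) 0`. -/
def negPart {m : Type} [Fintype m] [DecidableEq m] (M : symMat m) : symMat m :=
  ⟨(M.1)⁻, by
    have h : IsSelfAdjoint ((M.1)⁻) := by
      rw [CFC.negPart_def]
      exact cfcₙ_predicate _ _
    change ((M.1)⁻)ᵀ = (M.1)⁻
    rw [← Matrix.conjTranspose_eq_transpose_of_trivial]
    exact h⟩

/-- `R` is an upper triangular Cholesky factor of `K`. -/
def IsUpperCholesky {n : ℕ} (R K : Matrix (Fin n) (Fin n) ℝ) : Prop :=
  R.BlockTriangular id ∧ Rᵀ * R = K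

/-- The kernel matrix `K i j = k (x i) (x j)`. -/
def kernelMatrix {X : Type*} {n : ℕ} (k : X → X → ℝ) (x : Fin n → X) :
    Matrix (Fin n) (Fin n) ℝ :=
  Matrix.of fun i j => k (x i) (x j)

/-- The finite-dimensional features `Ψ ℓ = R_{:, ℓ} ⊗ I_d`, matrices of size `nd × d`. -/
def features {n : ℕ} (d : ℕ) (R : Matrix (Fin n) (Fin n) ℝ) (ℓ : Fin n) :
    Matrix (Fin n × Fin d) (Fin d) ℝ :=
  Matrix.of fun p b => R p.1 ℓ * (1 : Matrix (Fin d) (Fin d) ℝ) p.2 b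

variable {n d : ℕ}

/-- The evaluations `F_B(x_i) = Ψ_iᵀ B Ψ_i`, `i = 1, …, n`. -/
def evals (Ψ : Fin n → Matrix (Fin n × Fin d) (Fin d) ℝ) (B : symMat (Fin n × Fin d)) :
    Fin n → symMat (Fin d) :=
  fun i => ⟨(Ψ i)ᵀ * B.1 * Ψ i, by
    have hB : (B.1)ᵀ = B.1 := B.2
    change ((Ψ i)ᵀ * B.1 * Ψ i)ᵀ = (Ψ i)ᵀ * B.1 * Ψ i
    simp [Matrix.transpose_mul, hB, Matrix.mul_assoc]⟩

/-- The regularizer `λ₁ tr B + (λ₂ / 2) ‖B‖_F²`. -/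
def regularizer (lam₁ lam₂ : ℝ) (B : symMat (Fin n × Fin d)) : ℝ :=
  lam₁ * B.1.trace + lam₂ / 2 * frobSq B.1

/-- The objective `L (F_B(x_1), …, F_B(x_n)) + Ω(B)` of the primal problem. -/
def primalObj (L : (Fin n → symMat (Fin d)) → EReal)
    (Ψ : Fin n → Matrix (Fin n × Fin d) (Fin d) ℝ) (lam₁ lam₂ : ℝ)
    (B : symMat (Fin n × Fin d)) : EReal :=
  L (evals Ψ B) + (regularizer lam₁ lam₂ B : EReal)

/-- The effective domain of an extended-real-valued function. -/
def effDom {E : Type*} (L : E → EReal) : Set E := {X | L X < ⊤}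

/-- Convexity of an extended-real-valued function: its epigraph is convex. -/
def IsConvexFun {E : Type*} [AddCommGroup E] [Module ℝ E] (L : E → EReal) : Prop :=
  Convex ℝ {p : E × ℝ | L p.1 ≤ (p.2 : EReal)}

/-- The Fenchel conjugate `L*(Y) = sup_X (∑ i, ⟨Y i, X i⟩ - L X)`. -/
def fenchelConj (L : (Fin n → symMat (Fin d)) → EReal) (Y : Fin n → symMat (Fin d)) : EReal :=
  ⨆ X : Fin n → symMat (Fin d), ((∑ i, frobInner (Y i).1 (X i).1 : ℝ) : EReal) - L X

/-- The matrix `∑ i, Ψ_i Γ_i Ψ_iᵀ + λ₁ I`. -/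
def dualMat (Ψ : Fin n → Matrix (Fin n × Fin d) (Fin d) ℝ) (lam₁ : ℝ)
    (Γ : Fin n → symMat (Fin d)) : symMat (Fin n × Fin d) :=
  ⟨∑ i, Ψ i * (Γ i).1 * (Ψ i)ᵀ + lam₁ • (1 : Matrix (Fin n × Fin d) (Fin n × Fin d) ℝ), by
    have hΓ : ∀ i, ((Γ i).1)ᵀ = (Γ i).1 := fun i => (Γ i).2
    change (_ : Matrix _ _ ℝ)ᵀ = _
    simp [Matrix.transpose_add, Matrix.transpose_sum, Matrix.transpose_mul, hΓ,
      Matrix.mul_assoc]⟩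

/-- The dual objective `-L*(Γ) - (1 / (2 λ₂)) ‖[∑ i, Ψ_i Γ_i Ψ_iᵀ + λ₁ I]_-‖_F²`. -/
def dualObj (L : (Fin n → symMat (Fin d)) → EReal)
    (Ψ : Fin n → Matrix (Fin n × Fin d) (Fin d) ℝ) (lam₁ lam₂ : ℝ)
    (Γ : Fin n → symMat (Fin d)) : EReal :=
  -fenchelConj L Γ - ((1 / (2 * lam₂) * frobSq (negPart (dualMat Ψ lam₁ Γ)).1 : ℝ) : EReal)

end PSDLearning

end

/-!
The problem has the form `inf_{B ∈ K} L (A B) + G B` with `A` linear, `K` the cone of positive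
semidefinite matrices and `G` the regularizer. As the sets `{B ∈ K | G B ≤ ρ}` are compact and `L`
is bounded from below, the value function `Z ↦ inf_{B ∈ K} L (A B + Z) + G B` has a closed convex
epigraph. A point `(0, r)` below this epigraph is therefore strictly separated from it by a
hyperplane, which is not vertical because of the feasible point, and whose slope is a Lagrange
multiplier with dual value at least `r`: there is no duality gap. If `A B` is interior to the domain
of `L` for some `B ∈ K`, the epigraph has an interior point above `0` and a supporting hyperplane at
`(0, value)` is an optimal multiplier.

The multiplier `Γ` leaves the inner problem of minimizing `⟨M, B⟩ + λ₂ / 2 ‖B‖²` over `K`, where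
`M = ∑ i, Ψ_i Γ_i Ψ_iᵀ + λ₁ I`. Write `M = P - [M]₋` with `P` positive semidefinite and orthogonal
to `[M]₋`. If `λ₂ > 0`, completing the square and `⟨P, B⟩ ≥ 0` show that `λ₂⁻¹ [M]₋` is the unique
minimizer, so an optimal `Γ` forces a primal solution, which exists by compactness, to be
`λ₂⁻¹ [M]₋`. If `λ₂ = 0`, self-duality of `K` makes the minimum `0` when `M ∈ K` and `-∞` otherwise.
-/

noncomputable section

namespace PSDLearning

section Duality

open Filter Topology Set

variable {E F : Type*}

/-- The pairs `(Z, r)` for which some `B ∈ K` achieves `L (A B + Z) + G B ≤ r`. This is the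
epigraph of the value function `Z ↦ inf_{B ∈ K} L (A B + Z) + G B`, except that it contains
`(Z, r)` with `r` equal to the value only if the infimum is attained. -/
def valueEpigraph [Add E] (L : E → EReal) (A : F → E) (K : Set F) (G : F → ℝ) : Set (E × ℝ) :=
  {q | ∃ B ∈ K, L (A B + q.1) + (G B : EReal) ≤ (q.2 : EReal)}

/-- The Lagrange dual function of `inf_{B ∈ K} L (A B) + G B`: the infimum of the Lagrangian in
which `φ` is the multiplier of the constraint `X = A B`. -/
def lagrangeDual (L : E → EReal) (A : F → E) (K : Set F) (G : F → ℝ) (φ : E → ℝ) : EReal :=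
  ⨅ B ∈ K, ⨅ X, L X + ((φ (A B) - φ X + G B : ℝ) : EReal)

lemma add_coe_le_coe_iff {x : EReal} {g r : ℝ} :
    x + (g : EReal) ≤ (r : EReal) ↔ x ≤ ((r - g : ℝ) : EReal) :=
  (EReal.le_sub_iff_add_le (.inl (EReal.coe_ne_bot g)) (.inl (EReal.coe_ne_top g))).symm

lemma coe_le_add_coe_iff {x : EReal} {r t : ℝ} :
    (r : EReal) ≤ x + (t : EReal) ↔ ∀ s : ℝ, x ≤ (s : EReal) → r ≤ s + t := by
  induction x with
  | bot => simpa using ⟨r - t - 1, by linarith⟩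
  | top => simp
  | coe x =>
    norm_cast
    exact ⟨fun h s hs => by linarith, fun h => h x le_rfl⟩

section WeakDuality

variable {L : E → EReal} {A : F → E} {K : Set F} {G : F → ℝ} {φ : E → ℝ}

lemma lagrangeDual_le {B : F} (hB : B ∈ K) : lagrangeDual L A K G φ ≤ L (A B) + (G B : EReal) :=
  (iInf₂_le B hB).trans ((iInf_le _ (A B)).trans_eq (by simp))

lemma lagrangeDual_le_iInf : lagrangeDual L A K G φ ≤ ⨅ B ∈ K, L (A B) + (G B : EReal) :=
  le_iInf₂ fun _ => lagrangeDual_le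

lemma lagrangeDual_eq_of_isMinOn {B₀ : F} (hB₀ : B₀ ∈ K)
    (hmin : IsMinOn (fun B => φ (A B) + G B) K B₀) :
    lagrangeDual L A K G φ
      = (⨅ X, L X - (φ X : EReal)) + ((φ (A B₀) + G B₀ : ℝ) : EReal) := by
  have hsplit : ∀ B X, L X + ((φ (A B) - φ X + G B : ℝ) : EReal)
      = L X - (φ X : EReal) + ((φ (A B) + G B : ℝ) : EReal) := fun B X => by
    rw [sub_eq_add_neg (L X), add_assoc, ← EReal.coe_neg, ← EReal.coe_add]
    ring_nf
  simp only [lagrangeDual, hsplit]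
  refine le_antisymm ?_ (le_iInf₂ fun B hB => le_iInf fun X => ?_)
  · refine (EReal.sub_le_iff_le_add (.inl (EReal.coe_ne_bot _)) (.inl (EReal.coe_ne_top _))).1
      (le_iInf fun X => EReal.sub_le_of_le_add ?_)
    exact (iInf₂_le B₀ hB₀).trans (iInf_le _ X)
  · exact add_le_add (iInf_le _ X) (EReal.coe_le_coe_iff.2 (hmin hB))

lemma lagrangeDual_eq_bot (hdom : (effDom L).Nonempty)
    (hunbdd : ¬BddBelow ((fun B => φ (A B) + G B) '' K)) : lagrangeDual L A K G φ = ⊥ := by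
  obtain ⟨X, hX⟩ := hdom
  obtain ⟨s, hs, -⟩ := EReal.lt_iff_exists_real_btwn.1 hX
  refine (EReal.eq_bot_iff_forall_lt _).2 fun t => ?_
  simp only [not_bddBelow_iff, exists_mem_image] at hunbdd
  obtain ⟨B, hB, hlt⟩ := hunbdd (t - s + φ X)
  calc lagrangeDual L A K G φ ≤ L X + ((φ (A B) - φ X + G B : ℝ) : EReal) :=
        (iInf₂_le B hB).trans (iInf_le _ X)
    _ ≤ (s : EReal) + ((φ (A B) - φ X + G B : ℝ) : EReal) := by gcongr
    _ < t := by norm_cast; linarith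

lemma isMinOn_of_le_lagrangeDual {B₀ : F} (hbot : L (A B₀) ≠ ⊥) (hdom : A B₀ ∈ effDom L)
    (hgap : L (A B₀) + (G B₀ : EReal) ≤ lagrangeDual L A K G φ) :
    IsMinOn (fun B => φ (A B) + G B) K B₀ := fun B hB => by
  have h := hgap.trans ((iInf₂_le B hB).trans (iInf_le _ (A B₀)))
  lift L (A B₀) to ℝ using ⟨ne_of_lt hdom, hbot⟩ with l
  norm_cast at h
  change φ (A B₀) + G B₀ ≤ φ (A B) + G B
  linarith

end WeakDuality

section ValueEpigraph

variable {L : E → EReal} {K : Set F} {G : F → ℝ}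

lemma zero_mem_valueEpigraph_iff [AddZeroClass E] {A : F → E} {r : ℝ} :
    (0, r) ∈ valueEpigraph L A K G ↔ ∃ B ∈ K, L (A B) + (G B : EReal) ≤ (r : EReal) := by
  simp only [valueEpigraph, mem_ofPred_eq, add_zero]

lemma zero_notMem_valueEpigraph [AddZeroClass E] {A : F → E} {r : ℝ}
    (hr : (r : EReal) < ⨅ B ∈ K, L (A B) + (G B : EReal)) : (0, r) ∉ valueEpigraph L A K G := by
  rw [zero_mem_valueEpigraph_iff]
  rintro ⟨B, hB, hle⟩
  exact hr.not_ge ((iInf₂_le B hB).trans hle)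

lemma exists_zero_mem_valueEpigraph [AddZeroClass E] {A : F → E}
    (hfeas : ∃ B ∈ K, A B ∈ effDom L) : ∃ u : ℝ, (0, u) ∈ valueEpigraph L A K G := by
  obtain ⟨B, hB, hAB⟩ := hfeas
  obtain ⟨u, hu, -⟩ :=
    EReal.lt_iff_exists_real_btwn.1 (EReal.add_lt_top (ne_of_lt hAB) (EReal.coe_ne_top (G B)))
  exact ⟨u, zero_mem_valueEpigraph_iff.2 ⟨B, hB, hu.le⟩⟩

lemma convex_valueEpigraph [AddCommGroup E] [Module ℝ E] [AddCommGroup F] [Module ℝ F]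
    (A : F →ₗ[ℝ] E) (hL : IsConvexFun L) (hG : ConvexOn ℝ K G) :
    Convex ℝ (valueEpigraph L A K G) := by
  rintro ⟨Z₁, r₁⟩ ⟨B₁, hB₁, h₁⟩ ⟨Z₂, r₂⟩ ⟨B₂, hB₂, h₂⟩ a b ha hb hab
  refine ⟨a • B₁ + b • B₂, hG.1 hB₁ hB₂ ha hb hab, add_coe_le_coe_iff.2 ?_⟩
  have hcomb : A (a • B₁ + b • B₂) + (a • Z₁ + b • Z₂) = a • (A B₁ + Z₁) + b • (A B₂ + Z₂) := by
    simp only [map_add, map_smul, smul_add]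
    abel
  have hLcomb : L (a • (A B₁ + Z₁) + b • (A B₂ + Z₂))
      ≤ ((a * (r₁ - G B₁) + b * (r₂ - G B₂) : ℝ) : EReal) :=
    hL (x := (A B₁ + Z₁, r₁ - G B₁)) (add_coe_le_coe_iff.1 h₁)
      (y := (A B₂ + Z₂, r₂ - G B₂)) (add_coe_le_coe_iff.1 h₂) ha hb hab
  have hGcomb := hG.2 hB₁ hB₂ ha hb hab
  simp only [Prod.smul_mk, Prod.mk_add_mk, smul_eq_mul] at hGcomb ⊢
  rw [hcomb]
  exact hLcomb.trans (EReal.coe_le_coe_iff.2 (by linarith))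

lemma isClosed_setOf_le_coe [TopologicalSpace E] (hL : LowerSemicontinuous L) :
    IsClosed {p : E × ℝ | L p.1 ≤ (p.2 : EReal)} :=
  hL.isClosed_epigraph.preimage
    (continuous_fst.prodMk (continuous_coe_real_ereal.comp continuous_snd))

lemma isClosed_valueEpigraph [TopologicalSpace E] [Add E] [ContinuousAdd E] [TopologicalSpace F]
    {A : F → E} (hA : Continuous A) (hL : LowerSemicontinuous L) {c : ℝ}
    (hc : ∀ X, (c : EReal) ≤ L X) (hG : Continuous G)
    (hcpt : ∀ ρ, IsCompact {B ∈ K | G B ≤ ρ}) : IsClosed (valueEpigraph L A K G) := by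
  refine isClosed_iff_ultrafilter.2 fun q₀ u hu hmem => ?_
  have : Nonempty F := (u.nonempty_of_mem hmem).elim fun _ ⟨B, _⟩ => ⟨B⟩
  choose! β hβK hβ using fun q (hq : q ∈ valueEpigraph L A K G) => hq
  have hfst : Tendsto Prod.fst (u : Filter (E × ℝ)) (𝓝 q₀.1) :=
    (continuous_fst.tendsto q₀).mono_left hu
  have hsnd : Tendsto Prod.snd (u : Filter (E × ℝ)) (𝓝 q₀.2) :=
    (continuous_snd.tendsto q₀).mono_left hu
  have hsublevel : ∀ᶠ q in (u : Filter (E × ℝ)), β q ∈ {B ∈ K | G B ≤ q₀.2 + 1 - c} := by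
    filter_upwards [hmem, hsnd.eventually_lt_const (lt_add_one _)] with q hq hlt
    have hcq : c ≤ q.2 - G (β q) := by
      exact_mod_cast (hc _).trans (add_coe_le_coe_iff.1 (hβ q hq))
    exact ⟨hβK q hq, by linarith⟩
  obtain ⟨B₀, hB₀, hlim⟩ := (hcpt _).ultrafilter_le_nhds' (u.map β) hsublevel
  have hβlim : Tendsto β u (𝓝 B₀) := hlim
  refine ⟨B₀, hB₀.1, add_coe_le_coe_iff.2 ?_⟩
  have hpair : Tendsto (fun q => (A (β q) + q.1, q.2 - G (β q))) u
      (𝓝 (A B₀ + q₀.1, q₀.2 - G B₀)) :=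
    (((hA.tendsto B₀).comp hβlim).add hfst).prodMk_nhds
      (hsnd.sub ((hG.tendsto B₀).comp hβlim))
  refine (isClosed_setOf_le_coe hL).mem_of_tendsto hpair ?_
  filter_upwards [hmem] with q hq using add_coe_le_coe_iff.1 (hβ q hq)

end ValueEpigraph

lemma exists_isMinOn_add_coe [TopologicalSpace E] [TopologicalSpace F] {L : E → EReal}
    {A : F → E} {K : Set F} {G : F → ℝ} (hA : Continuous A) (hL : LowerSemicontinuous L) {c : ℝ}
    (hc : ∀ X, (c : EReal) ≤ L X) (hG : Continuous G)
    (hcpt : ∀ ρ, IsCompact {B ∈ K | G B ≤ ρ}) (hfeas : ∃ B ∈ K, A B ∈ effDom L) :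
    ∃ B₀ ∈ K, IsMinOn (fun B => L (A B) + (G B : EReal)) K B₀ := by
  have hlsc : LowerSemicontinuous fun B => L (A B) + (G B : EReal) :=
    (LowerSemicontinuous.comp hL hA).add' (continuous_coe_real_ereal.comp hG).lowerSemicontinuous
      fun _ => EReal.continuousAt_add (.inr (EReal.coe_ne_bot _)) (.inr (EReal.coe_ne_top _))
  have hcoer : ∀ B (ρ : ℝ), L (A B) + (G B : EReal) ≤ ρ → G B ≤ ρ - c := fun B ρ h => by
    have hcB : c ≤ ρ - G B := by exact_mod_cast (hc _).trans (add_coe_le_coe_iff.1 h)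
    linarith
  obtain ⟨B₁, hB₁, hAB₁⟩ := hfeas
  obtain ⟨ρ, hρ, -⟩ :=
    EReal.lt_iff_exists_real_btwn.1 (EReal.add_lt_top (ne_of_lt hAB₁) (EReal.coe_ne_top (G B₁)))
  have hB₁ρ : B₁ ∈ {B ∈ K | G B ≤ ρ - c} := ⟨hB₁, hcoer B₁ ρ hρ.le⟩
  obtain ⟨B₀, hB₀, hmin⟩ := (hlsc.lowerSemicontinuousOn _).exists_isMinOn ⟨B₁, hB₁ρ⟩ (hcpt _)
  refine ⟨B₀, hB₀.1, fun B hB => ?_⟩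
  by_cases hle : L (A B) + (G B : EReal) ≤ ρ
  · exact hmin ⟨hB, hcoer B ρ hle⟩
  · exact (hmin hB₁ρ).trans (hρ.le.trans (not_le.1 hle).le)

section StrongDuality

lemma exists_le_lagrangeDual_of_separating [TopologicalSpace E] [AddCommGroup E] [Module ℝ E]
    {L : E → EReal} {A : F → E} {K : Set F} {G : F → ℝ} {r u : ℝ} (f : StrongDual ℝ (E × ℝ))
    (hf : ∀ q ∈ valueEpigraph L A K G, f (0, r) ≤ f q) (hru : r ≤ u)
    (hpos : f (0, r) < f (0, u)) :
    ∃ φ : StrongDual ℝ E, (r : EReal) ≤ lagrangeDual L A K G φ := by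
  set a := f (0, 1)
  have hdec : ∀ Z s, f (Z, s) = f (Z, 0) + s * a := fun Z s => by
    rw [← smul_eq_mul, ← map_smul, ← map_add]
    simp
  have hf0 : f ((0 : E), (0 : ℝ)) = 0 := map_zero f
  have ha : 0 < a := by
    rw [hdec 0 r, hdec 0 u] at hpos
    exact pos_of_mul_pos_right (by linarith : 0 < (u - r) * a) (sub_nonneg.2 hru)
  refine ⟨-(a⁻¹ • f.comp (.inl ℝ E ℝ)), le_iInf₂ fun B hB => le_iInf fun X => ?_⟩
  refine coe_le_add_coe_iff.2 fun s hs => ?_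
  have hmem : (X - A B, s + G B) ∈ valueEpigraph L A K G :=
    ⟨B, hB, by simpa using add_le_add_left hs (G B : EReal)⟩
  have hsep : r * a ≤ f (X, 0) - f (A B, 0) + (s + G B) * a := by
    have hmk : (X - A B, (0 : ℝ)) = (X, 0) - (A B, 0) := by simp
    have h := hf _ hmem
    rwa [hdec 0, hf0, zero_add, hdec (X - A B), hmk, map_sub] at h
  have hdiv := (le_div_iff₀ ha).2 hsep
  simp only [neg_apply, smul_apply, ContinuousLinearMap.comp_apply,
    ContinuousLinearMap.inl_apply, smul_eq_mul]
  refine hdiv.trans_eq ?_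
  field_simp
  ring

variable {L : E → EReal} {K : Set F} {G : F → ℝ}

theorem iInf_eq_iSup_lagrangeDual [TopologicalSpace E] [AddCommGroup E] [Module ℝ E]
    [IsTopologicalAddGroup E] [ContinuousSMul ℝ E] [LocallyConvexSpace ℝ E]
    [TopologicalSpace F] [AddCommGroup F] [Module ℝ F] (A : F →L[ℝ] E) (hconv : IsConvexFun L)
    (hL : LowerSemicontinuous L) {c : ℝ} (hc : ∀ X, (c : EReal) ≤ L X) (hG : Continuous G)
    (hGc : ConvexOn ℝ K G) (hcpt : ∀ ρ, IsCompact {B ∈ K | G B ≤ ρ})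
    (hfeas : ∃ B ∈ K, A B ∈ effDom L) :
    (⨅ B ∈ K, L (A B) + (G B : EReal)) = ⨆ φ : StrongDual ℝ E, lagrangeDual L A K G φ := by
  refine le_antisymm ?_ (iSup_le fun φ => lagrangeDual_le_iInf)
  refine EReal.ge_of_forall_gt_iff_ge.1 fun r hr => ?_
  have hr' : (0, r) ∉ valueEpigraph L A K G := zero_notMem_valueEpigraph hr
  obtain ⟨u, hu⟩ := exists_zero_mem_valueEpigraph (G := G) hfeas
  have hru : r ≤ u := by
    obtain ⟨B, hB, hle⟩ := zero_mem_valueEpigraph_iff.1 hu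
    exact_mod_cast hr.le.trans ((iInf₂_le B hB).trans hle)
  obtain ⟨f, w, hw, hf⟩ := geometric_hahn_banach_point_closed
    (convex_valueEpigraph (A : F →ₗ[ℝ] E) hconv hGc)
    (isClosed_valueEpigraph A.continuous hL hc hG hcpt) hr'
  obtain ⟨φ, hφ⟩ := exists_le_lagrangeDual_of_separating f (fun q hq => (hw.trans (hf q hq)).le)
    hru (hw.trans (hf _ hu))
  exact hφ.trans (le_iSup (fun φ : StrongDual ℝ E => lagrangeDual L A K G φ) φ)

lemma exists_supporting_strongDual [TopologicalSpace E] [AddCommGroup E] [Module ℝ E]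
    [IsTopologicalAddGroup E] [ContinuousSMul ℝ E] {C : Set E} (hC : Convex ℝ C)
    (hne : (interior C).Nonempty) {x : E} (hx : x ∉ interior C) :
    ∃ f : StrongDual ℝ E, (∀ y ∈ C, f x ≤ f y) ∧ ∀ y ∈ interior C, f x < f y := by
  obtain ⟨f, hf⟩ := geometric_hahn_banach_point_open hC.interior isOpen_interior hx
  refine ⟨f, fun y hy => ?_, hf⟩
  have hcl : y ∈ closure (interior C) := by
    rw [hC.closure_interior_eq_closure_of_nonempty_interior hne]
    exact subset_closure hy
  exact closure_minimal (fun z hz => (hf z hz).le) (isClosed_le continuous_const f.continuous) hcl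

lemma IsConvexFun.convexOn_toReal [AddCommGroup E] [Module ℝ E] (hL : IsConvexFun L)
    (hbot : ∀ X, L X ≠ ⊥) : ConvexOn ℝ (effDom L) fun X => (L X).toReal := by
  have hcoe : ∀ X ∈ effDom L, ((L X).toReal : EReal) = L X := fun X hX =>
    EReal.coe_toReal (ne_of_lt hX) (hbot X)
  have hcomb : ∀ X ∈ effDom L, ∀ Y ∈ effDom L, ∀ a b : ℝ, 0 ≤ a → 0 ≤ b → a + b = 1 →
      L (a • X + b • Y) ≤ ((a * (L X).toReal + b * (L Y).toReal : ℝ) : EReal) :=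
    fun X hX Y hY a b ha hb hab => hL (x := (X, (L X).toReal)) (hcoe X hX).ge
      (y := (Y, (L Y).toReal)) (hcoe Y hY).ge ha hb hab
  have hdom : Convex ℝ (effDom L) := fun X hX Y hY a b ha hb hab =>
    (hcomb X hX Y hY a b ha hb hab).trans_lt (EReal.coe_lt_top _)
  refine ⟨hdom, fun X hX Y hY a b ha hb hab => ?_⟩
  have h := hcomb X hX Y hY a b ha hb hab
  rw [← hcoe _ (hdom hX hY ha hb hab)] at h
  exact_mod_cast h

lemma IsConvexFun.exists_eventually_le_of_mem_interior [NormedAddCommGroup E] [NormedSpace ℝ E]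
    [FiniteDimensional ℝ E] (hL : IsConvexFun L) (hbot : ∀ X, L X ≠ ⊥) {X₀ : E}
    (hX₀ : X₀ ∈ interior (effDom L)) : ∃ M : ℝ, ∀ᶠ X in 𝓝 X₀, L X ≤ (M : EReal) := by
  have hcont :=
    (hL.convexOn_toReal hbot).continuousOn_interior.continuousAt (isOpen_interior.mem_nhds hX₀)
  refine ⟨(L X₀).toReal + 1, ?_⟩
  filter_upwards [hcont.eventually_lt_const (lt_add_one _), isOpen_interior.mem_nhds hX₀]
    with X hX hXd
  have hX_top : L X ≠ ⊤ := ne_of_lt (show X ∈ effDom L from interior_subset hXd)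
  rw [← EReal.coe_toReal hX_top (hbot X)]
  exact_mod_cast hX.le

lemma zero_mem_interior_valueEpigraph [TopologicalSpace E] [AddCommGroup E]
    [IsTopologicalAddGroup E] {A : F → E} {B : F} (hB : B ∈ K) {M s : ℝ}
    (hM : ∀ᶠ X in 𝓝 (A B), L X ≤ (M : EReal)) (hs : M + G B < s) :
    (0, s) ∈ interior (valueEpigraph L A K G) := by
  rw [mem_interior_iff_mem_nhds, nhds_prod_eq]
  have htendsto : Tendsto (fun Z => A B + Z) (𝓝 0) (𝓝 (A B)) :=
    Continuous.tendsto' (by fun_prop) _ _ (add_zero _)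
  filter_upwards [(htendsto.eventually hM).prod_mk (lt_mem_nhds hs)] with q hq
  refine ⟨B, hB, (add_le_add_left hq.1 _).trans ?_⟩
  exact_mod_cast hq.2.le

lemma zero_notMem_interior_valueEpigraph [TopologicalSpace E] [AddZeroClass E] {A : F → E}
    {v : ℝ} (hv : (v : EReal) ≤ ⨅ B ∈ K, L (A B) + (G B : EReal)) :
    (0, v) ∉ interior (valueEpigraph L A K G) := fun h => by
  have hslice : Tendsto (fun s : ℝ => ((0 : E), s)) (𝓝 v) (𝓝 (0, v)) :=
    (Continuous.prodMk_right (0 : E)).tendsto v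
  have hev : ∀ᶠ s in 𝓝[<] v, ((0 : E), s) ∈ valueEpigraph L A K G :=
    (hslice.eventually (mem_interior_iff_mem_nhds.1 h)).filter_mono nhdsWithin_le_nhds
  obtain ⟨s, hs, hsv⟩ := (hev.and self_mem_nhdsWithin).exists
  exact zero_notMem_valueEpigraph ((EReal.coe_lt_coe_iff.2 hsv).trans_le hv) hs

theorem exists_iInf_le_lagrangeDual [NormedAddCommGroup E] [NormedSpace ℝ E]
    [FiniteDimensional ℝ E] [AddCommGroup F] [Module ℝ F] (A : F →ₗ[ℝ] E) (hconv : IsConvexFun L)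
    (hbot : ∀ X, L X ≠ ⊥) (hGc : ConvexOn ℝ K G) (hint : ∃ B ∈ K, A B ∈ interior (effDom L)) :
    ∃ φ : StrongDual ℝ E, (⨅ B ∈ K, L (A B) + (G B : EReal)) ≤ lagrangeDual L A K G φ := by
  obtain ⟨B, hB, hAB⟩ := hint
  obtain ⟨M, hM⟩ := hconv.exists_eventually_le_of_mem_interior hbot hAB
  have hvM : (⨅ B ∈ K, L (A B) + (G B : EReal)) ≤ ((M + G B : ℝ) : EReal) :=
    (iInf₂_le B hB).trans (add_le_add_left hM.self_of_nhds _)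
  generalize hv : (⨅ B ∈ K, L (A B) + (G B : EReal)) = v at hvM
  induction v with
  | bot => exact ⟨0, bot_le⟩
  | top => exact absurd hvM (not_le.2 (EReal.coe_lt_top _))
  | coe v =>
    have hvM : v ≤ M + G B := EReal.coe_le_coe_iff.1 hvM
    have hmem := zero_mem_interior_valueEpigraph hB hM (lt_add_one (M + G B))
    obtain ⟨f, hf, hlt⟩ := exists_supporting_strongDual (convex_valueEpigraph A hconv hGc)
      ⟨_, hmem⟩ (zero_notMem_interior_valueEpigraph hv.ge)
    exact exists_le_lagrangeDual_of_separating f hf (by linarith) (hlt _ hmem)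

end StrongDuality

end Duality

section Frobenius

variable {m : Type}

lemma convex_psdCone : Convex ℝ (psdCone m) := by
  intro A hA B hB a b ha hb _
  exact (Matrix.PosSemidef.smul hA ha).add (Matrix.PosSemidef.smul hB hb)

variable [Fintype m]

lemma frobInner_eq_sum (A B : Matrix m m ℝ) : frobInner A B = ∑ j, ∑ i, A i j * B i j := by
  simp [frobInner, Matrix.trace, Matrix.mul_apply]

lemma frobInner_comm (A B : Matrix m m ℝ) : frobInner A B = frobInner B A := by
  simp only [frobInner_eq_sum, mul_comm]

lemma frobInner_zero_right (A : Matrix m m ℝ) : frobInner A 0 = 0 := by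
  simp [frobInner]

lemma frobInner_add_left (A B C : Matrix m m ℝ) :
    frobInner (A + B) C = frobInner A C + frobInner B C := by
  simp [frobInner, Matrix.add_mul]

lemma frobInner_add_right (A B C : Matrix m m ℝ) :
    frobInner A (B + C) = frobInner A B + frobInner A C := by
  simp [frobInner, Matrix.mul_add]

lemma frobInner_sub_left (A B C : Matrix m m ℝ) :
    frobInner (A - B) C = frobInner A C - frobInner B C := by
  simp [frobInner, Matrix.sub_mul]

lemma frobInner_sub_right (A B C : Matrix m m ℝ) :
    frobInner A (B - C) = frobInner A B - frobInner A C := by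
  simp [frobInner, Matrix.mul_sub]

lemma frobInner_smul_left (a : ℝ) (A B : Matrix m m ℝ) :
    frobInner (a • A) B = a * frobInner A B := by
  simp [frobInner]

lemma frobInner_smul_right (a : ℝ) (A B : Matrix m m ℝ) :
    frobInner A (a • B) = a * frobInner A B := by
  simp [frobInner]

lemma continuous_frobInner_right (A : Matrix m m ℝ) : Continuous (frobInner A) := by
  unfold frobInner
  fun_prop

lemma continuous_frobSq : Continuous (frobSq : Matrix m m ℝ → ℝ) := by
  unfold frobSq frobInner
  fun_prop

lemma frobSq_sub_smul (A B : Matrix m m ℝ) (a : ℝ) :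
    frobSq (A - a • B) = frobSq A - 2 * a * frobInner B A + a ^ 2 * frobSq B := by
  simp only [frobSq, frobInner_sub_left, frobInner_sub_right, frobInner_smul_left,
    frobInner_smul_right, frobInner_comm A B]
  ring

lemma frobSq_smul (a : ℝ) (A : Matrix m m ℝ) : frobSq (a • A) = a ^ 2 * frobSq A := by
  simp only [frobSq, frobInner_smul_left, frobInner_smul_right]
  ring

lemma frobSq_convexCombo (A B : Matrix m m ℝ) {a b : ℝ} (hab : a + b = 1) :
    frobSq (a • A + b • B) = a * frobSq A + b * frobSq B - a * b * frobSq (A - B) := by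
  obtain rfl := eq_sub_of_add_eq' hab
  simp only [frobSq, frobInner_add_left, frobInner_add_right, frobInner_sub_left,
    frobInner_sub_right, frobInner_smul_left, frobInner_smul_right, frobInner_comm B A]
  ring

lemma sq_apply_le_frobSq (A : Matrix m m ℝ) (i j : m) : A i j ^ 2 ≤ frobSq A := by
  rw [frobSq, frobInner_eq_sum, sq]
  calc A i j * A i j ≤ ∑ i, A i j * A i j :=
        Finset.single_le_sum (f := fun i => A i j * A i j) (fun i _ => mul_self_nonneg _)
          (Finset.mem_univ i)
    _ ≤ _ := Finset.single_le_sum (f := fun j => ∑ i, A i j * A i j)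
        (fun j _ => Finset.sum_nonneg fun i _ => mul_self_nonneg _) (Finset.mem_univ j)

lemma frobSq_nonneg (A : Matrix m m ℝ) : 0 ≤ frobSq A := by
  rw [frobSq, frobInner_eq_sum]
  exact Finset.sum_nonneg fun j _ => Finset.sum_nonneg fun i _ => mul_self_nonneg _

lemma eq_zero_of_frobSq_nonpos {A : Matrix m m ℝ} (h : frobSq A ≤ 0) : A = 0 := by
  ext i j
  exact pow_eq_zero_iff two_ne_zero |>.1 (le_antisymm ((sq_apply_le_frobSq A i j).trans h)
    (sq_nonneg _))

open scoped MatrixOrder in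
lemma frobInner_nonneg {A B : Matrix m m ℝ} (hA : A.PosSemidef) (hB : B.PosSemidef) :
    0 ≤ frobInner A B := by
  classical
  obtain ⟨C, rfl⟩ := CStarAlgebra.nonneg_iff_eq_star_mul_self.1 (Matrix.nonneg_iff_posSemidef.2 hA)
  have hcyc : frobInner (star C * C) B = (C * B * Cᴴ).trace := by
    rw [frobInner, ← Matrix.conjTranspose_eq_transpose_of_trivial, Matrix.star_eq_conjTranspose,
      (Matrix.isHermitian_conjTranspose_mul_self C).eq, Matrix.mul_assoc, Matrix.trace_mul_comm]
  rw [hcyc]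
  exact (hB.mul_mul_conjTranspose_same C).trace_nonneg

lemma frobInner_vecMulVec_self (M : symMat m) (x : m → ℝ) :
    frobInner M.1 (Matrix.vecMulVec x x) = x ⬝ᵥ (M.1 *ᵥ x) := by
  have hM : (M.1)ᵀ = M.1 := M.2
  rw [frobInner, hM, Matrix.mul_vecMulVec, Matrix.trace_vecMulVec, dotProduct_comm]

lemma mem_psdCone_iff_forall_frobInner_nonneg {M : symMat m} :
    M ∈ psdCone m ↔ ∀ B ∈ psdCone m, 0 ≤ frobInner M.1 B.1 := by
  refine ⟨fun hM B hB => frobInner_nonneg hM hB, fun h => ?_⟩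
  refine Matrix.PosSemidef.of_dotProduct_mulVec_nonneg (Matrix.isHermitian_iff_isSymm.2 M.2)
    fun x => ?_
  have hx : (Matrix.vecMulVec x x).PosSemidef := by
    simpa using Matrix.posSemidef_vecMulVec_self_star x
  rw [star_trivial, ← frobInner_vecMulVec_self]
  exact h ⟨_, Matrix.isHermitian_iff_isSymm.1 hx.1⟩ hx

lemma isClosed_psdCone {ι : Type} [Finite ι] : IsClosed (psdCone ι) := by
  cases nonempty_fintype ι
  have hinter : psdCone ι = ⋂ B ∈ psdCone ι, {M | 0 ≤ frobInner B.1 M.1} := by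
    ext M
    simp only [Set.mem_iInter, Set.mem_ofPred_eq, frobInner_comm _ M.1]
    exact mem_psdCone_iff_forall_frobInner_nonneg
  rw [hinter]
  exact isClosed_biInter fun B _ => isClosed_le continuous_const
    ((continuous_frobInner_right B.1).comp continuous_subtype_val)

lemma abs_apply_le_trace {B : Matrix m m ℝ} (hB : B.PosSemidef) (i j : m) :
    |B i j| ≤ B.trace := by
  classical
  have hdiag : ∀ k, B k k ≤ B.trace := fun k =>
    Finset.single_le_sum (f := fun k => B k k) (fun l _ => hB.diag_nonneg) (Finset.mem_univ k)
  have hsymm : B j i = B i j := by simpa using hB.1.apply i j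
  have hquad : ∀ t : ℝ, 0 ≤ B i i + 2 * t * B i j + t * t * B j j := fun t => by
    have h := hB.dotProduct_mulVec_nonneg (Pi.single i 1 + t • Pi.single j 1)
    simp only [star_trivial, Matrix.mulVec_add, Matrix.mulVec_single, MulOpposite.op_one, one_smul,
      Matrix.mulVec_smul, dotProduct_add, add_dotProduct, single_dotProduct, Matrix.col_apply,
      one_mul, smul_dotProduct, hsymm, smul_eq_mul, dotProduct_smul] at h
    linarith
  rw [abs_le]
  constructor <;> linarith [hdiag i, hdiag j, hquad 1, hquad (-1)]

section NegPart

variable [DecidableEq m]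

open scoped MatrixOrder in
lemma negPart_mem_psdCone (M : symMat m) : negPart M ∈ psdCone m :=
  Matrix.nonneg_iff_posSemidef.1 (CFC.negPart_nonneg M.1)

open scoped MatrixOrder in
lemma exists_eq_sub_negPart (M : symMat m) : ∃ P ∈ psdCone m,
    M.1 = P.1 - (negPart M).1 ∧ frobInner P.1 (negPart M).1 = 0 := by
  have hM : IsSelfAdjoint M.1 := Matrix.isHermitian_iff_isSymm.2 M.2
  have hP : ((M.1)⁺).PosSemidef := Matrix.nonneg_iff_posSemidef.1 (CFC.posPart_nonneg _)
  have hPsymm : ((M.1)⁺).IsSymm := Matrix.isHermitian_iff_isSymm.1 hP.1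
  refine ⟨⟨_, hPsymm⟩, hP, (CFC.posPart_sub_negPart _ hM).symm, ?_⟩
  change (((M.1)⁺)ᵀ * (M.1)⁻).trace = 0
  rw [hPsymm.eq, CFC.posPart_mul_negPart, Matrix.trace_zero]

variable (M : symMat m) {μ : ℝ}

lemma smul_negPart_mem_psdCone (hμ : 0 < μ) : μ⁻¹ • negPart M ∈ psdCone m :=
  Matrix.PosSemidef.smul (negPart_mem_psdCone M) (inv_nonneg.2 hμ.le)

lemma frobInner_add_frobSq_smul_negPart (hμ : 0 < μ) :
    frobInner M.1 (μ⁻¹ • negPart M).1 + μ / 2 * frobSq (μ⁻¹ • negPart M).1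
      = -(1 / (2 * μ) * frobSq (negPart M).1) := by
  obtain ⟨P, -, hM, horth⟩ := exists_eq_sub_negPart M
  have hMN : frobInner M.1 (negPart M).1 = -frobSq (negPart M).1 := by
    rw [hM, frobInner_sub_left, horth, zero_sub, frobSq]
  rw [Submodule.coe_smul, frobInner_smul_right, frobSq_smul, hMN]
  field_simp
  ring

/-- The left-hand side is `-⟨[M]₋, B⟩ + μ / 2 ‖B‖²` with the square completed, and the right-hand
side exceeds it by the inner product of `B` and the positive part of `M`. -/
lemma half_mul_frobSq_sub_le (hμ : 0 < μ) {B : symMat m} (hB : B ∈ psdCone m) :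
    μ / 2 * frobSq (B.1 - μ⁻¹ • (negPart M).1) - 1 / (2 * μ) * frobSq (negPart M).1
      ≤ frobInner M.1 B.1 + μ / 2 * frobSq B.1 := by
  obtain ⟨P, hP, hM, -⟩ := exists_eq_sub_negPart M
  have hPB := frobInner_nonneg hP hB
  have hMB : frobInner M.1 B.1 = frobInner P.1 B.1 - frobInner (negPart M).1 B.1 := by
    conv_lhs => rw [hM, frobInner_sub_left]
  have hsquare : μ / 2 * frobSq (B.1 - μ⁻¹ • (negPart M).1) - 1 / (2 * μ) * frobSq (negPart M).1
      = μ / 2 * frobSq B.1 - frobInner (negPart M).1 B.1 := by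
    rw [frobSq_sub_smul]
    field_simp
    ring
  linarith

lemma isMinOn_frobInner_add_frobSq (hμ : 0 < μ) :
    IsMinOn (fun B : symMat m => frobInner M.1 B.1 + μ / 2 * frobSq B.1) (psdCone m)
      (μ⁻¹ • negPart M) := fun B hB => by
  have hle := half_mul_frobSq_sub_le M hμ hB
  have hnonneg := mul_nonneg (half_pos hμ).le (frobSq_nonneg (B.1 - μ⁻¹ • (negPart M).1))
  have hval := frobInner_add_frobSq_smul_negPart M hμ
  change _ ≤ frobInner M.1 B.1 + μ / 2 * frobSq B.1
  linarith

lemma eq_smul_negPart_of_isMinOn (hμ : 0 < μ) {B : symMat m} (hB : B ∈ psdCone m)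
    (hmin : IsMinOn (fun B : symMat m => frobInner M.1 B.1 + μ / 2 * frobSq B.1) (psdCone m) B) :
    B = μ⁻¹ • negPart M := by
  have hle := half_mul_frobSq_sub_le M hμ hB
  have hBval : frobInner M.1 B.1 + μ / 2 * frobSq B.1 ≤ -(1 / (2 * μ) * frobSq (negPart M).1) :=
    (hmin (smul_negPart_mem_psdCone M hμ)).trans_eq (frobInner_add_frobSq_smul_negPart M hμ)
  have hzero : frobSq (B.1 - μ⁻¹ • (negPart M).1) ≤ 0 :=
    nonpos_of_mul_nonpos_right (by linarith) (half_pos hμ)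
  exact Subtype.ext (sub_eq_zero.1 (eq_zero_of_frobSq_nonpos hzero))

end NegPart

section Compactness

attribute [local instance] Matrix.normedAddCommGroup Matrix.normedSpace

lemma norm_le_sqrt_frobSq (A : symMat m) : ‖A‖ ≤ √(frobSq A.1) :=
  (Matrix.norm_le_iff (Real.sqrt_nonneg _)).2 fun i j =>
    Real.abs_le_sqrt (sq_apply_le_frobSq A.1 i j)

lemma norm_le_trace {B : symMat m} (hB : B ∈ psdCone m) : ‖B‖ ≤ B.1.trace :=
  (Matrix.norm_le_iff (Matrix.PosSemidef.trace_nonneg hB)).2 (abs_apply_le_trace hB)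

lemma isCompact_psdCone_inter_le {G : symMat m → ℝ} (hG : Continuous G) {ρ r : ℝ} (C : symMat m)
    (hball : ∀ B ∈ psdCone m, G B ≤ ρ → ‖B - C‖ ≤ r) : IsCompact {B ∈ psdCone m | G B ≤ ρ} :=
  Metric.isCompact_of_isClosed_isBounded
    (isClosed_psdCone.inter (isClosed_le hG continuous_const))
    ((Metric.isBounded_closedBall (x := C) (r := r)).subset fun B hB =>
      mem_closedBall_iff_norm.2 (hball B hB.1 hB.2))

lemma isCompact_smul_trace_le {a : ℝ} (ha : 0 < a) (ρ : ℝ) :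
    IsCompact {B ∈ psdCone m | a * B.1.trace ≤ ρ} := by
  refine isCompact_psdCone_inter_le (by fun_prop) (r := ρ / a) 0 fun B hB hle => ?_
  rw [sub_zero, le_div_iff₀' ha]
  exact (mul_le_mul_of_nonneg_left (norm_le_trace hB) ha.le).trans hle

lemma isCompact_frobInner_add_frobSq_le (M : symMat m) {μ : ℝ} (hμ : 0 < μ) (ρ : ℝ) :
    IsCompact {B ∈ psdCone m | frobInner M.1 B.1 + μ / 2 * frobSq B.1 ≤ ρ} := by
  classical
  have hcont : Continuous fun B : symMat m => frobInner M.1 B.1 + μ / 2 * frobSq B.1 :=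
    ((continuous_frobInner_right M.1).comp continuous_subtype_val).add
      ((continuous_frobSq.comp continuous_subtype_val).const_mul (μ / 2))
  refine isCompact_psdCone_inter_le hcont
    (r := √((ρ + 1 / (2 * μ) * frobSq (negPart M).1) / (μ / 2))) (μ⁻¹ • negPart M)
    fun B hB hle => (norm_le_sqrt_frobSq _).trans (Real.sqrt_le_sqrt ?_)
  rw [le_div_iff₀' (half_pos hμ)]
  have hsquare := half_mul_frobSq_sub_le M hμ hB
  change μ / 2 * frobSq (B.1 - μ⁻¹ • (negPart M).1) ≤ _
  linarith

end Compactness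

end Frobenius

section Problem

attribute [local instance] Matrix.normedAddCommGroup Matrix.normedSpace

variable {n d : ℕ}

/-- The evaluations `evals Ψ` as a continuous linear map, which is the operator `A` of the abstract
duality theorems. -/
def evalsCLM (Ψ : Fin n → Matrix (Fin n × Fin d) (Fin d) ℝ) :
    symMat (Fin n × Fin d) →L[ℝ] (Fin n → symMat (Fin d)) :=
  LinearMap.toContinuousLinearMap
    { toFun := evals Ψ
      map_add' := fun A B => by
        ext i a b
        simp [evals, Matrix.mul_add, Matrix.add_mul]
      map_smul' := fun c A => by
        ext i a b
        simp [evals] }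

/-- The pairing `(Γ, X) ↦ ∑ i, ⟨Γ i, X i⟩`, through which a dual variable `Γ` of the problem acts as
a Lagrange multiplier. -/
def pairing : (Fin n → symMat (Fin d)) →ₗ[ℝ] Module.Dual ℝ (Fin n → symMat (Fin d)) :=
  LinearMap.mk₂ ℝ (fun Γ X : Fin n → symMat (Fin d) => ∑ i, frobInner (Γ i).1 (X i).1)
    (fun _ _ _ => by simp [frobInner_add_left, Finset.sum_add_distrib])
    (fun _ _ _ => by simp [frobInner_smul_left, Finset.mul_sum])
    (fun _ _ _ => by simp [frobInner_add_right, Finset.sum_add_distrib])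
    (fun _ _ _ => by simp [frobInner_smul_right, Finset.mul_sum])

lemma pairing_apply (Γ X : Fin n → symMat (Fin d)) :
    pairing Γ X = ∑ i, frobInner (Γ i).1 (X i).1 := rfl

lemma pairing_injective : Function.Injective (pairing (n := n) (d := d)) := by
  refine (injective_iff_map_eq_zero _).2 fun Γ hΓ => ?_
  have hsum : ∑ i, frobSq (Γ i).1 = 0 := LinearMap.congr_fun hΓ Γ
  rw [Finset.sum_eq_zero_iff_of_nonneg fun i _ => frobSq_nonneg _] at hsum
  ext1 i
  exact Subtype.ext (eq_zero_of_frobSq_nonpos (hsum i (Finset.mem_univ i)).le)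

lemma exists_coe_pairing_eq (φ : StrongDual ℝ (Fin n → symMat (Fin d))) :
    ∃ Γ, ⇑(pairing Γ) = φ := by
  have hsurj : Function.Surjective (pairing (n := n) (d := d)) :=
    (LinearMap.injective_iff_surjective_of_finrank_eq_finrank
      Subspace.dual_finrank_eq.symm).1 pairing_injective
  obtain ⟨Γ, hΓ⟩ := hsurj φ.toLinearMap
  exact ⟨Γ, congrArg DFunLike.coe hΓ⟩

lemma neg_fenchelConj (L : (Fin n → symMat (Fin d)) → EReal) (Γ : Fin n → symMat (Fin d)) :
    -fenchelConj L Γ = ⨅ X, L X - (pairing Γ X : EReal) := by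
  rw [fenchelConj, show ∀ x : EReal, -x = OrderDual.ofDual (EReal.negOrderIso x) from fun _ => rfl,
    OrderIso.map_iSup]
  refine iInf_congr fun X => ?_
  change -(((pairing Γ X : ℝ) : EReal) - L X) = _
  rw [EReal.neg_sub (.inl (EReal.coe_ne_bot _)) (.inl (EReal.coe_ne_top _)), add_comm,
    sub_eq_add_neg]

variable (Ψ : Fin n → Matrix (Fin n × Fin d) (Fin d) ℝ)

lemma frobInner_dualMat (lam₁ : ℝ) (Γ : Fin n → symMat (Fin d)) (B : symMat (Fin n × Fin d)) :
    frobInner (dualMat Ψ lam₁ Γ).1 B.1 = pairing Γ (evals Ψ B) + lam₁ * B.1.trace := by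
  have hcyc : ∀ i, ((Ψ i * ((Γ i).1ᵀ * (Ψ i)ᵀ)) * B.1).trace
      = ((Γ i).1ᵀ * ((Ψ i)ᵀ * B.1 * Ψ i)).trace := fun i => by
    rw [Matrix.mul_assoc, Matrix.trace_mul_comm]
    simp only [Matrix.mul_assoc]
  simp [pairing_apply, frobInner, dualMat, evals, Matrix.transpose_add, Matrix.transpose_sum,
    Matrix.transpose_mul, Matrix.add_mul, Matrix.sum_mul, Matrix.trace_sum, hcyc]

lemma pairing_add_regularizer (lam₁ lam₂ : ℝ) (Γ : Fin n → symMat (Fin d))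
    (B : symMat (Fin n × Fin d)) :
    pairing Γ (evalsCLM Ψ B) + regularizer lam₁ lam₂ B
      = frobInner (dualMat Ψ lam₁ Γ).1 B.1 + lam₂ / 2 * frobSq B.1 := by
  rw [frobInner_dualMat, regularizer, add_assoc]
  rfl

lemma pairing_add_regularizer_zero (lam₁ : ℝ) (Γ : Fin n → symMat (Fin d))
    (B : symMat (Fin n × Fin d)) :
    pairing Γ (evalsCLM Ψ B) + regularizer lam₁ 0 B = frobInner (dualMat Ψ lam₁ Γ).1 B.1 := by
  rw [pairing_add_regularizer, zero_div, zero_mul, add_zero]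

lemma continuous_regularizer (lam₁ lam₂ : ℝ) :
    Continuous (regularizer (n := n) (d := d) lam₁ lam₂) := by
  have htrace : Continuous fun B : symMat (Fin n × Fin d) => B.1.trace := by fun_prop
  exact (htrace.const_mul lam₁).add
    ((continuous_frobSq.comp continuous_subtype_val).const_mul (lam₂ / 2))

lemma convexOn_regularizer (lam₁ : ℝ) {lam₂ : ℝ} (h₂ : 0 ≤ lam₂) :
    ConvexOn ℝ (psdCone (Fin n × Fin d)) (regularizer lam₁ lam₂) := by
  refine ⟨convex_psdCone, fun A _ B _ a b ha hb hab => ?_⟩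
  have hgap : 0 ≤ lam₂ / 2 * (a * b * frobSq (A.1 - B.1)) := by
    have := frobSq_nonneg (A.1 - B.1)
    positivity
  simp only [regularizer, Submodule.coe_add, Submodule.coe_smul, Matrix.trace_add,
    Matrix.trace_smul, smul_eq_mul, frobSq_convexCombo A.1 B.1 hab]
  linarith

lemma isCompact_regularizer_le (lam₁ : ℝ) {lam₂ : ℝ} (h₂ : 0 < lam₂) (ρ : ℝ) :
    IsCompact {B ∈ psdCone (Fin n × Fin d) | regularizer lam₁ lam₂ B ≤ ρ} := by
  have hreg : ∀ B : symMat (Fin n × Fin d), regularizer lam₁ lam₂ B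
      = frobInner (dualMat 0 lam₁ 0).1 B.1 + lam₂ / 2 * frobSq B.1 := fun B => by
    simp [frobInner_dualMat, regularizer]
  simp only [hreg]
  exact isCompact_frobInner_add_frobSq_le _ h₂ ρ

lemma isCompact_regularizer_zero_le {lam₁ : ℝ} (h₁ : 0 < lam₁) (ρ : ℝ) :
    IsCompact {B ∈ psdCone (Fin n × Fin d) | regularizer lam₁ 0 B ≤ ρ} := by
  simpa [regularizer] using isCompact_smul_trace_le (m := Fin n × Fin d) h₁ ρ

section DualFunction

variable (L : (Fin n → symMat (Fin d)) → EReal)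

lemma isMinOn_pairing_add_regularizer (lam₁ : ℝ) {lam₂ : ℝ} (h₂ : 0 < lam₂)
    (Γ : Fin n → symMat (Fin d)) :
    IsMinOn (fun B => pairing Γ (evalsCLM Ψ B) + regularizer lam₁ lam₂ B)
      (psdCone (Fin n × Fin d)) (lam₂⁻¹ • negPart (dualMat Ψ lam₁ Γ)) := by
  simp only [pairing_add_regularizer]
  exact isMinOn_frobInner_add_frobSq _ h₂

lemma lagrangeDual_pairing_eq_dualObj (lam₁ : ℝ) {lam₂ : ℝ} (h₂ : 0 < lam₂)
    (Γ : Fin n → symMat (Fin d)) :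
    lagrangeDual L (evalsCLM Ψ) (psdCone (Fin n × Fin d)) (regularizer lam₁ lam₂) (pairing Γ)
      = dualObj L Ψ lam₁ lam₂ Γ := by
  rw [lagrangeDual_eq_of_isMinOn (smul_negPart_mem_psdCone _ h₂)
      (isMinOn_pairing_add_regularizer Ψ lam₁ h₂ Γ),
    pairing_add_regularizer, frobInner_add_frobSq_smul_negPart _ h₂, ← neg_fenchelConj, dualObj,
    sub_eq_add_neg, ← EReal.coe_neg]

lemma lagrangeDual_pairing_of_mem_psdCone {lam₁ : ℝ} {Γ : Fin n → symMat (Fin d)}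
    (hΓ : dualMat Ψ lam₁ Γ ∈ psdCone (Fin n × Fin d)) :
    lagrangeDual L (evalsCLM Ψ) (psdCone (Fin n × Fin d)) (regularizer lam₁ 0) (pairing Γ)
      = -fenchelConj L Γ := by
  have hmin : IsMinOn (fun B => pairing Γ (evalsCLM Ψ B) + regularizer lam₁ 0 B)
      (psdCone (Fin n × Fin d)) 0 := fun B hB => by
    change pairing Γ (evalsCLM Ψ 0) + _ ≤ pairing Γ (evalsCLM Ψ B) + _
    rw [pairing_add_regularizer_zero, pairing_add_regularizer_zero, Submodule.coe_zero,
      frobInner_zero_right]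
    exact frobInner_nonneg hΓ hB
  have hzero : (0 : symMat (Fin n × Fin d)) ∈ psdCone (Fin n × Fin d) := Matrix.PosSemidef.zero
  rw [lagrangeDual_eq_of_isMinOn hzero hmin, pairing_add_regularizer_zero, Submodule.coe_zero,
    frobInner_zero_right, neg_fenchelConj, EReal.coe_zero, add_zero]

variable {L}

lemma lagrangeDual_pairing_of_notMem_psdCone (hdom : (effDom L).Nonempty) {lam₁ : ℝ}
    {Γ : Fin n → symMat (Fin d)} (hΓ : dualMat Ψ lam₁ Γ ∉ psdCone (Fin n × Fin d)) :
    lagrangeDual L (evalsCLM Ψ) (psdCone (Fin n × Fin d)) (regularizer lam₁ 0) (pairing Γ)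
      = ⊥ := by
  rw [mem_psdCone_iff_forall_frobInner_nonneg] at hΓ
  push Not at hΓ
  obtain ⟨B, hB, hneg⟩ := hΓ
  refine lagrangeDual_eq_bot hdom fun ⟨b, hb⟩ => ?_
  obtain ⟨t, ht⟩ := exists_nat_gt (b / frobInner (dualMat Ψ lam₁ Γ).1 B.1)
  have htB : b ≤ t * frobInner (dualMat Ψ lam₁ Γ).1 B.1 := hb
    ⟨(t : ℝ) • B, Matrix.PosSemidef.smul hB t.cast_nonneg,
      (pairing_add_regularizer_zero Ψ lam₁ Γ _).trans (frobInner_smul_right _ _ _)⟩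
  exact htB.not_gt ((div_lt_iff_of_neg hneg).1 ht)

lemma iSup_lagrangeDual_pairing_zero (hdom : (effDom L).Nonempty) (lam₁ : ℝ) :
    (⨆ Γ, lagrangeDual L (evalsCLM Ψ) (psdCone (Fin n × Fin d)) (regularizer lam₁ 0) (pairing Γ))
      = ⨆ Γ ∈ {Γ | dualMat Ψ lam₁ Γ ∈ psdCone (Fin n × Fin d)}, -fenchelConj L Γ := by
  refine iSup_congr fun Γ => ?_
  rw [Set.mem_ofPred_eq]
  by_cases hΓ : dualMat Ψ lam₁ Γ ∈ psdCone (Fin n × Fin d)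
  · rw [iSup_pos hΓ, lagrangeDual_pairing_of_mem_psdCone Ψ L hΓ]
  · rw [iSup_neg hΓ, lagrangeDual_pairing_of_notMem_psdCone Ψ hdom hΓ]

end DualFunction

variable {L : (Fin n → symMat (Fin d)) → EReal} {Ψ}

lemma iInf_primalObj_eq_iSup_lagrangeDual (hconv : IsConvexFun L) (hlsc : LowerSemicontinuous L)
    {c : ℝ} (hc : ∀ X, (c : EReal) ≤ L X)
    (hfeas : ∃ B ∈ psdCone (Fin n × Fin d), evals Ψ B ∈ effDom L) {lam₁ lam₂ : ℝ} (h₂ : 0 ≤ lam₂)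
    (hcpt : ∀ ρ, IsCompact {B ∈ psdCone (Fin n × Fin d) | regularizer lam₁ lam₂ B ≤ ρ}) :
    (⨅ B ∈ psdCone (Fin n × Fin d), primalObj L Ψ lam₁ lam₂ B)
      = ⨆ Γ, lagrangeDual L (evalsCLM Ψ) (psdCone (Fin n × Fin d)) (regularizer lam₁ lam₂)
          (pairing Γ) := by
  have : LocallyConvexSpace ℝ (Fin n → symMat (Fin d)) := NormedSpace.toLocallyConvexSpace
  refine le_antisymm ?_ (iSup_le fun Γ => lagrangeDual_le_iInf)
  refine (iInf_eq_iSup_lagrangeDual (evalsCLM Ψ) hconv hlsc hc (continuous_regularizer lam₁ lam₂)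
    (convexOn_regularizer lam₁ h₂) hcpt hfeas).trans_le (iSup_le fun φ => ?_)
  obtain ⟨Γ, hΓ⟩ := exists_coe_pairing_eq φ
  rw [← hΓ]
  exact le_iSup (fun Γ => lagrangeDual L (evalsCLM Ψ) _ (regularizer lam₁ lam₂) (pairing Γ)) Γ

theorem iInf_primalObj_eq_iSup_dualObj (hconv : IsConvexFun L) (hlsc : LowerSemicontinuous L)
    {c : ℝ} (hc : ∀ X, (c : EReal) ≤ L X)
    (hfeas : ∃ B ∈ psdCone (Fin n × Fin d), evals Ψ B ∈ effDom L) (lam₁ : ℝ) {lam₂ : ℝ}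
    (h₂ : 0 < lam₂) :
    (⨅ B ∈ psdCone (Fin n × Fin d), primalObj L Ψ lam₁ lam₂ B)
      = ⨆ Γ, dualObj L Ψ lam₁ lam₂ Γ := by
  rw [iInf_primalObj_eq_iSup_lagrangeDual hconv hlsc hc hfeas h₂.le
    (isCompact_regularizer_le lam₁ h₂)]
  simp only [lagrangeDual_pairing_eq_dualObj Ψ L lam₁ h₂]

theorem exists_isMaxOn_dualObj (hconv : IsConvexFun L) (hbot : ∀ X, L X ≠ ⊥)
    (hint : ∃ B ∈ psdCone (Fin n × Fin d), evals Ψ B ∈ interior (effDom L)) (lam₁ : ℝ) {lam₂ : ℝ}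
    (h₂ : 0 < lam₂) : ∃ Γ, IsMaxOn (dualObj L Ψ lam₁ lam₂) Set.univ Γ := by
  obtain ⟨φ, hφ⟩ := exists_iInf_le_lagrangeDual (evalsCLM Ψ).toLinearMap hconv hbot
    (convexOn_regularizer lam₁ h₂.le) hint
  obtain ⟨Γ, hΓ⟩ := exists_coe_pairing_eq φ
  have hgap : (⨅ B ∈ psdCone (Fin n × Fin d), primalObj L Ψ lam₁ lam₂ B)
      ≤ lagrangeDual L (evalsCLM Ψ) (psdCone (Fin n × Fin d)) (regularizer lam₁ lam₂)
          (pairing Γ) := by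
    rw [hΓ]
    exact hφ
  refine ⟨Γ, fun Γ' _ => ?_⟩
  change dualObj L Ψ lam₁ lam₂ Γ' ≤ dualObj L Ψ lam₁ lam₂ Γ
  rw [← lagrangeDual_pairing_eq_dualObj Ψ L lam₁ h₂, ← lagrangeDual_pairing_eq_dualObj Ψ L lam₁ h₂]
  exact lagrangeDual_le_iInf.trans hgap

theorem isMinOn_primalObj_of_isMaxOn_dualObj (hconv : IsConvexFun L)
    (hlsc : LowerSemicontinuous L) {c : ℝ} (hc : ∀ X, (c : EReal) ≤ L X)
    (hfeas : ∃ B ∈ psdCone (Fin n × Fin d), evals Ψ B ∈ effDom L) {lam₁ lam₂ : ℝ}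
    (h₂ : 0 < lam₂) {Γ : Fin n → symMat (Fin d)}
    (hΓ : IsMaxOn (dualObj L Ψ lam₁ lam₂) Set.univ Γ) :
    IsMinOn (primalObj L Ψ lam₁ lam₂) (psdCone (Fin n × Fin d))
      (lam₂⁻¹ • negPart (dualMat Ψ lam₁ Γ)) := by
  obtain ⟨B₀, hB₀, hmin⟩ := exists_isMinOn_add_coe (evalsCLM Ψ).continuous hlsc hc
    (continuous_regularizer lam₁ lam₂) (isCompact_regularizer_le lam₁ h₂) hfeas
  have hdom : evalsCLM Ψ B₀ ∈ effDom L := by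
    obtain ⟨B, hB, hBL⟩ := hfeas
    have htop : primalObj L Ψ lam₁ lam₂ B₀ < ⊤ :=
      (hmin hB).trans_lt (EReal.add_lt_top (ne_of_lt hBL) (EReal.coe_ne_top _))
    exact lt_top_iff_ne_top.2 fun h => htop.ne ((congrArg (· + _) h).trans (EReal.top_add_coe _))
  have hgap : primalObj L Ψ lam₁ lam₂ B₀ ≤ lagrangeDual L (evalsCLM Ψ) (psdCone (Fin n × Fin d))
      (regularizer lam₁ lam₂) (pairing Γ) := by
    rw [lagrangeDual_pairing_eq_dualObj Ψ L lam₁ h₂]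
    calc primalObj L Ψ lam₁ lam₂ B₀ ≤ ⨅ B ∈ psdCone (Fin n × Fin d), primalObj L Ψ lam₁ lam₂ B :=
          le_iInf₂ fun B hB => hmin hB
      _ = ⨆ Γ, dualObj L Ψ lam₁ lam₂ Γ :=
          iInf_primalObj_eq_iSup_dualObj hconv hlsc hc hfeas lam₁ h₂
      _ ≤ dualObj L Ψ lam₁ lam₂ Γ := iSup_le fun Γ' => hΓ (Set.mem_univ Γ')
  have hlagr := isMinOn_of_le_lagrangeDual
    ((EReal.bot_lt_coe c).trans_le (hc _)).ne' hdom hgap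
  simp only [pairing_add_regularizer] at hlagr
  rw [← eq_smul_negPart_of_isMinOn _ h₂ hB₀ hlagr]
  exact hmin

theorem iInf_primalObj_zero_eq_iSup_neg_fenchelConj (hconv : IsConvexFun L)
    (hlsc : LowerSemicontinuous L) {c : ℝ} (hc : ∀ X, (c : EReal) ≤ L X)
    (hfeas : ∃ B ∈ psdCone (Fin n × Fin d), evals Ψ B ∈ effDom L) {lam₁ : ℝ} (h₁ : 0 < lam₁) :
    (⨅ B ∈ psdCone (Fin n × Fin d), primalObj L Ψ lam₁ 0 B)
      = ⨆ Γ ∈ {Γ | dualMat Ψ lam₁ Γ ∈ psdCone (Fin n × Fin d)}, -fenchelConj L Γ := by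
  rw [iInf_primalObj_eq_iSup_lagrangeDual hconv hlsc hc hfeas le_rfl
    (isCompact_regularizer_zero_le h₁)]
  obtain ⟨B, -, hB⟩ := hfeas
  exact iSup_lagrangeDual_pairing_zero Ψ ⟨_, hB⟩ lam₁

end Problem

end PSDLearning

end

open PSDLearning in
theorem mainTheorem3_general {n d : ℕ} (Ψ : Fin n → Matrix (Fin n × Fin d) (Fin d) ℝ)
    (L : (Fin n → symMat (Fin d)) → EReal) (hconv : IsConvexFun L) (hlsc : LowerSemicontinuous L)
    (hbdd : ∃ c : ℝ, ∀ Y, (c : EReal) ≤ L Y)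
    (hfeas : ∃ B ∈ psdCone (Fin n × Fin d), evals Ψ B ∈ effDom L) (lam₁ lam₂ : ℝ) :
    (0 < lam₂ →
      (⨅ B ∈ psdCone (Fin n × Fin d), primalObj L Ψ lam₁ lam₂ B)
          = (⨆ Γ, dualObj L Ψ lam₁ lam₂ Γ)
      ∧ ((∃ B ∈ psdCone (Fin n × Fin d), evals Ψ B ∈ interior (effDom L)) →
          ∃ Γ, IsMaxOn (dualObj L Ψ lam₁ lam₂) Set.univ Γ)
      ∧ ∀ Γ, IsMaxOn (dualObj L Ψ lam₁ lam₂) Set.univ Γ →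
          lam₂⁻¹ • negPart (dualMat Ψ lam₁ Γ) ∈ psdCone (Fin n × Fin d)
          ∧ IsMinOn (primalObj L Ψ lam₁ lam₂) (psdCone (Fin n × Fin d))
              (lam₂⁻¹ • negPart (dualMat Ψ lam₁ Γ)))
    ∧ (lam₂ = 0 → 0 < lam₁ →
      (⨅ B ∈ psdCone (Fin n × Fin d), primalObj L Ψ lam₁ lam₂ B)
        = (⨆ Γ ∈ {Γ : Fin n → symMat (Fin d) | dualMat Ψ lam₁ Γ ∈ psdCone (Fin n × Fin d)},
            -fenchelConj L Γ)) := by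
  obtain ⟨c, hc⟩ := hbdd
  have hbot : ∀ Y, L Y ≠ ⊥ := fun Y => ((EReal.bot_lt_coe c).trans_le (hc Y)).ne'
  refine ⟨fun h₂ => ⟨?_, fun hint => ?_, fun Γ hΓ => ⟨?_, ?_⟩⟩, ?_⟩
  · exact iInf_primalObj_eq_iSup_dualObj hconv hlsc hc hfeas lam₁ h₂
  · exact exists_isMaxOn_dualObj hconv hbot hint lam₁ h₂
  · exact smul_negPart_mem_psdCone _ h₂
  · exact isMinOn_primalObj_of_isMaxOn_dualObj hconv hlsc hc hfeas h₂ hΓ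
  · rintro rfl h₁
    exact iInf_primalObj_zero_eq_iSup_neg_fenchelConj hconv hlsc hc hfeas h₁

open PSDLearning in
theorem mainTheorem3 {X : Type*} (n d : ℕ)
    -- a positive definite kernel, sample points, and the features built from them
    (k : X → X → ℝ) (hk : (Matrix.of k).PosSemidef) (x : Fin n → X)
    (R : Matrix (Fin n) (Fin n) ℝ) (hR : IsUpperCholesky R (kernelMatrix k x))
    (L : (Fin n → symMat (Fin d)) → EReal)
    (hconv : IsConvexFun L) (hlsc : LowerSemicontinuous L)
    (hbdd : ∃ c : ℝ, ∀ Y, (c : EReal) ≤ L Y)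
    (hfeas : ∃ B ∈ psdCone (Fin n × Fin d), evals (features d R) B ∈ effDom L)
    (lam₁ lam₂ : ℝ) :
    (0 < lam₂ → 0 ≤ lam₁ →
      (⨅ B ∈ psdCone (Fin n × Fin d), primalObj L (features d R) lam₁ lam₂ B)
          = (⨆ Γ, dualObj L (features d R) lam₁ lam₂ Γ)
      -- attainment; the qualification always holds when `L` is finite everywhere
      ∧ ((∃ B ∈ psdCone (Fin n × Fin d), evals (features d R) B ∈ interior (effDom L)) →
          ∃ Γ, IsMaxOn (dualObj L (features d R) lam₁ lam₂) Set.univ Γ)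
      ∧ ∀ Γ, IsMaxOn (dualObj L (features d R) lam₁ lam₂) Set.univ Γ →
          lam₂⁻¹ • negPart (dualMat (features d R) lam₁ Γ) ∈ psdCone (Fin n × Fin d)
          ∧ IsMinOn (primalObj L (features d R) lam₁ lam₂) (psdCone (Fin n × Fin d))
              (lam₂⁻¹ • negPart (dualMat (features d R) lam₁ Γ)))
    ∧ (lam₂ = 0 → 0 < lam₁ →
      (⨅ B ∈ psdCone (Fin n × Fin d), primalObj L (features d R) lam₁ lam₂ B)
        = (⨆ Γ ∈ {Γ : Fin n → symMat (Fin d) |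
            dualMat (features d R) lam₁ Γ ∈ psdCone (Fin n × Fin d)}, -fenchelConj L Γ)) := by
  obtain ⟨hpos, hzero⟩ :=
    mainTheorem3_general (features d R) L hconv hlsc hbdd hfeas lam₁ lam₂
  exact ⟨fun h₂ _ => hpos h₂, hzero⟩
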